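/- Let $(R,\mathfrak m)$ be a complete Noetherian (commutative) local ring and let $\mathcal M$ be a class of $R$-modules that is closed under submodules and quotient modules and contains all finitely generated $R$-modules. A closure operation $\mathrm{cl}$ on $\mathcal M$ assigns to every $M\in\mathcal M$ and every submodule $L\subseteq M$ a submodule $L^{\mathrm{cl}}_M$ with $L\subseteq L^{\mathrm{cl}}_M\subseteq M$, such that $(L^{\mathrm{cl}}_M)^{\mathrm{cl}}_M=L^{\mathrm{cl}}_M$, and $L^{\mathrm{cl}}_M\subseteq N^{\mathrm{cl}}_M$ whenever $L\subseteq N\subseteq M$. It is functorial if $g(L^{\mathrm{cl}}_M)\subseteq g(L)^{\mathrm{cl}}_N$ for all $R$-linear maps $g:M\to N$ in $\mathcal M$ and all $L\subseteq M$, and residual if $(\ker q)^{\mathrm{cl}}_M=q^{-1}(0^{\mathrm{cl}}_P)$ for all surjective $R$-linear maps $q:M\to P$ in $\mathcal M$. For an ideal $I$ of $R$ write $I^{\mathrm{cl}}=I^{\mathrm{cl}}_R$; $I$ is $\mathrm{cl}$-closed if $I^{\mathrm{cl}}=I$. A Noetherian local ring is Gorenstein if it has finite injective dimension as a module over itself,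 and approximately Gorenstein if it has a decreasing sequence of ideals, primary to the maximal ideal and cofinal with the powers of the maximal ideal, whose quotient rings are Gorenstein. Let $\mathrm{cl}$ be a functorial and residual closure operation on $\mathcal M$. (1) Suppose that $R$ is approximately Gorenstein and that $\{J_t\}_{t\in\mathbb N}$ is a sequence of irreducible $\mathfrak m$-primary ideals of $R$ that is cofinal with the powers of $\mathfrak m$ (for every $n$ there is $t$ with $J_t\subseteq\mathfrak m^n$) such that every $J_t$ is $\mathrm{cl}$-closed. Then $I^{\mathrm{cl}}=I$ for every ideal $I$ of $R$, and $0^{\mathrm{cl}}_M=0$ for every finitely generated $R$-module $M$. (2) Suppose that $R$ is Gorenstein and that there is a system of parameters $x_1,\dots,x_d$ of $R$ (where $d=\dim R$) such that the ideal $(x_1^t,\dots,x_d^t)$ is $\mathrm{cl}$-closed for infinitely many $t\in\mathbb N$. Then $I^{\mathrm{cl}}=I$ for every ideal $I$ of $R$, and $0^{\mathrm{cl}}_M=0$ for every finitely generated $R$-module $M$. -/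

import Mathlib

universe u

/-- A class of `R`-modules closed under taking submodules and quotient modules. -/
structure ModuleClass (R : Type u) [CommRing R] where
  /-- Membership of a module in the class. -/
  Mem : ∀ (M : Type u) [AddCommGroup M] [Module R M], Prop
  submodule : ∀ (M : Type u) [AddCommGroup M] [Module R M] (N : Submodule R M), Mem M → Mem N
  quotient : ∀ (M : Type u) [AddCommGroup M] [Module R M] (N : Submodule R M),
    Mem M → Mem (M ⧸ N)

/-- A closure operation on a class `𝓜` of modules: for every `M` in `𝓜`, an extensive,
order-preserving, idempotent operator `L ↦ L^cl_M` on the submodules of `M`.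
No compatibility between different modules `M` is part of this notion. -/
def ClosureOperation {R : Type u} [CommRing R] (𝓜 : ModuleClass R) : Type (u + 1) :=
  ∀ (M : Type u) [AddCommGroup M] [Module R M], 𝓜.Mem M → ClosureOperator (Submodule R M)

namespace ClosureOperation

variable {R : Type u} [CommRing R] {𝓜 : ModuleClass R}

/-- `cl` is functorial: `g(L^cl_M) ⊆ g(L)^cl_N` for every linear map `g : M → N` in `𝓜` and
every submodule `L` of `M`. -/
def IsFunctorial (cl : ClosureOperation 𝓜) : Prop :=
  ∀ (M N : Type u) [AddCommGroup M] [Module R M] [AddCommGroup N] [Module R N]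
    (hM : 𝓜.Mem M) (hN : 𝓜.Mem N) (g : M →ₗ[R] N) (L : Submodule R M),
    (cl M hM L).map g ≤ cl N hN (L.map g)

/-- `cl` is residual: `(ker q)^cl_M = q⁻¹(0^cl_P)` for every surjection `q : M → P` in `𝓜`. -/
def IsResidual (cl : ClosureOperation 𝓜) : Prop :=
  ∀ (M P : Type u) [AddCommGroup M] [Module R M] [AddCommGroup P] [Module R P]
    (hM : 𝓜.Mem M) (hP : 𝓜.Mem P) (q : M →ₗ[R] P), Function.Surjective q →
    cl M hM (LinearMap.ker q) = (cl P hP ⊥).comap q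

end ClosureOperation

/-- A Gorenstein local ring: a Noetherian local ring of finite injective dimension as a module
over itself. -/
structure IsGorensteinLocal (R : Type u) [CommRing R] : Prop where
  isLocalRing : IsLocalRing R
  isNoetherianRing : IsNoetherianRing R
  finite_injectiveDimension :
    ∃ n : ℕ, CategoryTheory.HasInjectiveDimensionLE (ModuleCat.of.{u} R R) n

/-- The ideal `I` of the local ring `R` is primary to the maximal ideal. -/
def IsMaxPrimary {R : Type u} [CommRing R] [IsLocalRing R] (I : Ideal R) : Prop :=
  I.IsPrimary ∧ I.radical = IsLocalRing.maximalIdeal R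

/-- An approximately Gorenstein local ring: a Noetherian local ring with a decreasing sequence of
`𝔪`-primary ideals, cofinal with the powers of `𝔪`, whose quotient rings are Gorenstein. -/
structure IsApproximatelyGorenstein (R : Type u) [CommRing R] [IsLocalRing R] : Prop where
  isNoetherianRing : IsNoetherianRing R
  exists_sequence : ∃ I : ℕ → Ideal R, Antitone I ∧
    (∀ t, IsMaxPrimary (I t) ∧ IsGorensteinLocal (R ⧸ I t)) ∧
    ∀ n : ℕ, ∃ t, I t ≤ IsLocalRing.maximalIdeal R ^ n

/-- `x₁, …, x_d` is a system of parameters of the local ring `R`: `d = dim R` and the ideal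
`(x₁, …, x_d)` has radical `𝔪`. -/
def IsSystemOfParameters {R : Type u} [CommRing R] [IsLocalRing R] {d : ℕ} (x : Fin d → R) :
    Prop :=
  ringKrullDim R = (d : WithBot ℕ∞) ∧
    (Ideal.span (Set.range x)).radical = IsLocalRing.maximalIdeal R

/-!
Suppose that `R ⧸ J` is self-injective with `J` an `𝔪`-primary closed ideal. By residuality `0` is
closed in `R ⧸ J`, so by functoriality every `R`-linear map `M → R ⧸ J` kills `0^cl_M`. Such maps
separate the points of `M ⧸ JM`, since `R ⧸ J` is injective over itself and contains the residue
field; hence `0^cl_M ⊆ JM`. If such `J` occur inside every power of `𝔪`, then `0^cl_M = 0` for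
finitely generated `M` by Krull's intersection theorem, and `M = R ⧸ I` gives `I^cl = I`.

If `J` is irreducible, then `Hom(S, R ⧸ J)` has length at most one for every simple `S`, so
`length Hom(N, R ⧸ J) ≤ length N`, and counting lengths in `0 → I → A → A ⧸ I → 0` with `A = R ⧸ J`
shows that `Hom(A, A) → Hom(I, A)` is surjective: `A` is self-injective.

If `R` is Gorenstein and `rs` is a regular sequence with `𝔪 ∈ Ass (R ⧸ (rs))`, then `R ⧸ (rs)` has
projective dimension `|rs|`, so `Ext^i(R ⧸ (rs), R) = 0` for `i > |rs|`. As the residue field embeds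
into `R ⧸ (rs)`, descending induction from the injective dimension gives `Ext^i(-, R) = 0` for
`i = |rs| + 1` on all finitely generated modules. Shifting along `rs` turns this into exactness of
`Hom(-, R ⧸ (rs))` on modules killed by `rs`, so `R ⧸ (rs)` is self-injective. For a maximal regular
sequence this forces `dim R ⧸ (rs) = 0`, that is `|rs| = dim R`; then every system of parameters is
itself a regular sequence, and the same argument applies to it.
-/

section IrreducibleZero

variable {A : Type u} [CommRing A] {E : Type*} [AddCommGroup E] [Module A E]

theorem length_linearMap_le_one_of_isSimpleModule (hE : InfIrred (⊥ : Submodule A E))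
    (S : Type*) [AddCommGroup S] [Module A S] [IsSimpleModule A S] :
    Module.length A (S →ₗ[A] E) ≤ 1 := by
  rcases subsingleton_or_nontrivial (S →ₗ[A] E) with h | h
  · simp
  suffices IsSimpleModule A (S →ₗ[A] E) by rw [Module.length_eq_one]
  refine isSimpleModule_iff_toSpanSingleton_surjective.mpr ⟨h, fun φ hφ ψ => ?_⟩
  by_cases hψ : ψ = 0
  · exact ⟨0, by simp [hψ]⟩
  have range_ne_bot {χ : S →ₗ[A] E} (hχ : χ ≠ 0) : LinearMap.range χ ≠ ⊥ := by
    rwa [ne_eq, LinearMap.range_eq_bot]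
  obtain ⟨_, ⟨⟨s, rfl⟩, t, hts⟩, hs⟩ := Submodule.exists_mem_ne_zero_of_ne_bot
    fun h => (hE.2 h).elim (range_ne_bot hφ) (range_ne_bot hψ)
  have ht : t ≠ 0 := fun h => hs (by rw [← hts, h, map_zero])
  obtain ⟨c, hc : c • t = s⟩ := IsSimpleModule.toSpanSingleton_surjective A ht s
  have hct : c • φ t = ψ t := by rw [← map_smul, hc, hts]
  refine ⟨c, LinearMap.ext fun v => ?_⟩
  obtain ⟨r, rfl⟩ := IsSimpleModule.toSpanSingleton_surjective A ht v
  simp [← hct]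

theorem length_linearMap_eq_add_length_range_lcomp_subtype {M : Type*} [AddCommGroup M]
    [Module A M] (N : Submodule A M) :
    Module.length A (M →ₗ[A] E) = Module.length A ((M ⧸ N) →ₗ[A] E) +
      Module.length A (LinearMap.range (LinearMap.lcomp A E N.subtype)) := by
  refine Module.length_eq_add_of_exact (LinearMap.lcomp A E N.mkQ)
    (LinearMap.lcomp A E N.subtype).rangeRestrict
    (LinearMap.lcomp_injective_of_surjective _ N.mkQ_surjective)
    (LinearMap.surjective_rangeRestrict _) ?_
  rw [LinearMap.exact_iff, LinearMap.ker_rangeRestrict, ← LinearMap.exact_iff]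
  exact LinearMap.exact_lcomp_of_exact_of_surjective E (LinearMap.exact_subtype_mkQ N)
    N.mkQ_surjective

theorem length_eq_length_quotient_add_length {M : Type*} [AddCommGroup M] [Module A M]
    (N : Submodule A M) :
    Module.length A M = Module.length A (M ⧸ N) + Module.length A N := by
  rw [add_comm, ← Module.length_eq_add_of_exact N.subtype N.mkQ N.subtype_injective
    N.mkQ_surjective (LinearMap.exact_subtype_mkQ N)]

theorem length_linearMap_le_length (hE : InfIrred (⊥ : Submodule A E))
    {M : Type*} [AddCommGroup M] [Module A M] (hM : IsFiniteLength A M) :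
    Module.length A (M →ₗ[A] E) ≤ Module.length A M := by
  induction hM with
  | of_subsingleton => simp
  | @of_simple_quotient M _ _ N _ _ ih =>
    rw [length_linearMap_eq_add_length_range_lcomp_subtype N,
      length_eq_length_quotient_add_length N, Module.length_eq_one A (M ⧸ N)]
    exact add_le_add (length_linearMap_le_one_of_isSimpleModule hE (M ⧸ N))
      ((Module.length_le_of_injective _ (Submodule.subtype_injective _)).trans ih)

theorem injective_self_of_infIrred_bot [IsArtinianRing A] (hA : InfIrred (⊥ : Ideal A)) :
    Module.Injective A A := by
  have length_hom_le (M : Type u) [AddCommGroup M] [Module A M] [Module.Finite A M] :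
      Module.length A (M →ₗ[A] A) ≤ Module.length A M :=
    length_linearMap_le_length hA
      (isFiniteLength_iff_isNoetherian_isArtinian.mpr ⟨inferInstance, inferInstance⟩)
  refine Module.Baer.injective (Module.Baer.iff_surjective.mpr fun I => ?_)
  set ρ := LinearMap.lcomp A A I.subtype
  by_contra hρ
  have range_lt : Module.length A (LinearMap.range ρ) < Module.length A I :=
    (Submodule.length_lt fun h => hρ (LinearMap.range_eq_top.mp h)).trans_le (length_hom_le I)
  have hfin : Module.length A ((A ⧸ I) →ₗ[A] A) ≠ ⊤ :=
    ne_top_of_le_ne_top Module.length_ne_top (length_hom_le (A ⧸ I))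
  refine lt_irrefl (Module.length A A) ?_
  calc Module.length A A
      = Module.length A ((A ⧸ I) →ₗ[A] A) + Module.length A (LinearMap.range ρ) := by
        rw [← length_linearMap_eq_add_length_range_lcomp_subtype,
          (LinearMap.ringLmapEquivSelf A A A).length_eq]
    _ < Module.length A ((A ⧸ I) →ₗ[A] A) + Module.length A I :=
        (ENat.add_lt_add_iff_left hfin).mpr range_lt
    _ ≤ Module.length A (A ⧸ I) + Module.length A I := by gcongr; exact length_hom_le (A ⧸ I)
    _ = Module.length A A := (length_eq_length_quotient_add_length I).symm

theorem infIrred_bot_quotient {J : Ideal A} (hJ : InfIrred J) : InfIrred (⊥ : Ideal (A ⧸ J)) := by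
  have : Nontrivial (A ⧸ J) := Ideal.Quotient.nontrivial_iff.mpr hJ.ne_top
  refine ⟨fun h => bot_ne_top h.eq_top, fun K L hKL => ?_⟩
  have comap_inj := Ideal.comap_injective_of_surjective (Ideal.Quotient.mk J)
    Ideal.Quotient.mk_surjective
  have comap_bot : Ideal.comap (Ideal.Quotient.mk J) ⊥ = J := by
    rw [← RingHom.ker_eq_comap_bot, Ideal.mk_ker]
  have comap_inf : K.comap (Ideal.Quotient.mk J) ⊓ L.comap (Ideal.Quotient.mk J) = J := by
    rw [← Ideal.comap_inf, hKL, comap_bot]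
  exact (hJ.2 comap_inf).imp (fun h => comap_inj (h.trans comap_bot.symm))
    fun h => comap_inj (h.trans comap_bot.symm)

theorem isArtinianRing_quotient_of_radical_eq_maximalIdeal [IsLocalRing A] [IsNoetherianRing A]
    {J : Ideal A} (hJ : J.radical = IsLocalRing.maximalIdeal A) : IsArtinianRing (A ⧸ J) := by
  refine IsLocalRing.quotient_artinian_of_mem_minimalPrimes_of_isLocalRing J ?_
  rw [← Ideal.radical_minimalPrimes, hJ, Ideal.minimalPrimes_eq_subsingleton_self]
  rfl

theorem injective_self_quotient_of_infIrred [IsLocalRing A] [IsNoetherianRing A] {J : Ideal A}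
    (hirr : InfIrred J) (hrad : J.radical = IsLocalRing.maximalIdeal A) :
    Module.Injective (A ⧸ J) (A ⧸ J) :=
  have := isArtinianRing_quotient_of_radical_eq_maximalIdeal hrad
  injective_self_of_infIrred_bot (infIrred_bot_quotient hirr)

end IrreducibleZero

section Closure

theorem maximalIdeal_mem_associatedPrimes_self (A : Type u) [CommRing A] [IsLocalRing A]
    [IsArtinianRing A] : IsLocalRing.maximalIdeal A ∈ associatedPrimes A A := by
  obtain ⟨p, hp⟩ := associatedPrimes.nonempty A A
  have := hp.isPrime
  rwa [← Ring.KrullDimLE.eq_maximalIdeal_of_isPrime p]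

theorem exists_linearMap_apply_ne_zero {A : Type u} [CommRing A] [IsLocalRing A]
    [IsNoetherianRing A] {E : Type u} [AddCommGroup E] [Module A E] [Module.Injective A E]
    (hE : IsLocalRing.maximalIdeal A ∈ associatedPrimes A E)
    {N : Type u} [AddCommGroup N] [Module A N] {u : N} (hu : u ≠ 0) :
    ∃ φ : N →ₗ[A] E, φ u ≠ 0 := by
  obtain ⟨-, ι, hι⟩ := (isAssociatedPrime_iff_exists_injective_linearMap _ _).mp hE
  let ev := LinearMap.toSpanSingleton A N u
  have ker_le : LinearMap.ker ev ≤ IsLocalRing.maximalIdeal A :=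
    IsLocalRing.le_maximalIdeal ((Ideal.ne_top_iff_one _).mpr (by simpa [ev] using hu))
  obtain ⟨φ, hφ⟩ := Module.Injective.extension_property A _ _ _
    ((LinearMap.ker ev).liftQ ev le_rfl)
    (LinearMap.ker_eq_bot.mp (Submodule.ker_liftQ_eq_bot _ _ _ le_rfl))
    (ι ∘ₗ Submodule.factor ker_le)
  have hφu : φ u = ι 1 := by
    have h := LinearMap.congr_fun hφ (Submodule.Quotient.mk 1)
    rwa [LinearMap.comp_apply, Submodule.liftQ_apply, LinearMap.toSpanSingleton_apply_one] at h
  refine ⟨φ, ?_⟩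
  rw [hφu, map_ne_zero_iff ι hι]
  exact one_ne_zero

namespace ClosureOperation

variable {R : Type u} [CommRing R] {𝓜 : ModuleClass R} {cl : ClosureOperation 𝓜}

theorem IsResidual.bot_quotient_eq_bot_iff (hres : cl.IsResidual)
    {M : Type u} [AddCommGroup M] [Module R M] (hM : 𝓜.Mem M) (L : Submodule R M)
    (hL : 𝓜.Mem (M ⧸ L)) : cl (M ⧸ L) hL ⊥ = ⊥ ↔ cl M hM L = L := by
  have hcl : cl M hM L = (cl (M ⧸ L) hL ⊥).comap L.mkQ := by
    simpa only [L.ker_mkQ] using hres M (M ⧸ L) hM hL L.mkQ L.mkQ_surjective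
  have hbot : (⊥ : Submodule R (M ⧸ L)).comap L.mkQ = L := L.ker_mkQ
  rw [hcl, ← (Submodule.comap_injective_of_surjective L.mkQ_surjective).eq_iff, hbot]

theorem IsFunctorial.apply_eq_zero_of_mem_bot (hfun : cl.IsFunctorial)
    {M N : Type u} [AddCommGroup M] [Module R M] [AddCommGroup N] [Module R N]
    (hM : 𝓜.Mem M) (hN : 𝓜.Mem N) (hbot : cl N hN ⊥ = ⊥) (g : M →ₗ[R] N) {u : M}
    (hu : u ∈ cl M hM ⊥) : g u = 0 := by
  have hgu := hfun M N hM hN g ⊥ ⟨u, hu, rfl⟩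
  rwa [Submodule.map_bot, hbot] at hgu

variable [IsLocalRing R] [IsNoetherianRing R]

theorem mem_smul_top_of_mem_bot (hfun : cl.IsFunctorial) (hres : cl.IsResidual) {J : Ideal R}
    (hrad : J.radical = IsLocalRing.maximalIdeal R) (hinj : Module.Injective (R ⧸ J) (R ⧸ J))
    (hR : 𝓜.Mem R) (hJ : cl R hR J = J)
    {M : Type u} [AddCommGroup M] [Module R M] (hM : 𝓜.Mem M) {u : M} (hu : u ∈ cl M hM ⊥) :
    u ∈ (J • ⊤ : Submodule R M) := by
  have hJtop : J ≠ ⊤ := by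
    rw [ne_eq, ← Ideal.radical_eq_top, hrad]
    exact Ideal.IsPrime.ne_top'
  have : Nontrivial (R ⧸ J) := Ideal.Quotient.nontrivial_iff.mpr hJtop
  have : IsLocalRing (R ⧸ J) := .of_surjective' (Ideal.Quotient.mk J) Ideal.Quotient.mk_surjective
  have := isArtinianRing_quotient_of_radical_eq_maximalIdeal hrad
  have hJbot : cl (R ⧸ J) (𝓜.quotient R J hR) ⊥ = ⊥ := (hres.bot_quotient_eq_bot_iff hR J _).mpr hJ
  rw [← Submodule.Quotient.mk_eq_zero]
  by_contra hu0
  obtain ⟨φ, hφ⟩ :=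
    exists_linearMap_apply_ne_zero (maximalIdeal_mem_associatedPrimes_self (R ⧸ J)) hu0
  exact hφ (hfun.apply_eq_zero_of_mem_bot hM _ hJbot
    (φ.restrictScalars R ∘ₗ (J • ⊤ : Submodule R M).mkQ) hu)

theorem bot_eq_bot_of_injective_quotient (hfun : cl.IsFunctorial) (hres : cl.IsResidual)
    (hR : 𝓜.Mem R)
    (hsmall : ∀ n : ℕ, ∃ J ≤ IsLocalRing.maximalIdeal R ^ n,
      J.radical = IsLocalRing.maximalIdeal R ∧ Module.Injective (R ⧸ J) (R ⧸ J) ∧ cl R hR J = J)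
    {M : Type u} [AddCommGroup M] [Module R M] [Module.Finite R M] (hM : 𝓜.Mem M) :
    cl M hM ⊥ = ⊥ := by
  refine eq_bot_iff.mpr fun u hu => ?_
  rw [← Ideal.iInf_pow_smul_eq_bot_of_isLocalRing (M := M) (IsLocalRing.maximalIdeal R)
    Ideal.IsPrime.ne_top', Submodule.mem_iInf]
  intro n
  obtain ⟨J, hJn, hrad, hinj, hJ⟩ := hsmall n
  exact Submodule.smul_mono_left hJn (mem_smul_top_of_mem_bot hfun hres hrad hinj hR hJ hM hu)

end ClosureOperation

end Closure

section ExtVanishing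

open CategoryTheory Abelian IsLocalRing

variable {R : Type u} [CommRing R]

theorem ext_smul_eq_zero_of_mem_annihilator {X M : ModuleCat.{u} R} {y : R}
    (hy : y ∈ Module.annihilator R X) {n : ℕ} (b : Ext X M n) : y • b = 0 := by
  have hzero : y • 𝟙 X = 0 := by
    rw [← ModuleCat.lsmul_eq_smul_id, Module.mem_annihilator_iff_lsmul_eq_zero.mp hy]
    rfl
  rw [← Ext.mk₀_id_comp b, ← Ext.smul_comp, ← Ext.mk₀_smul, hzero, Ext.mk₀_zero, Ext.zero_comp]

theorem subsingleton_ext_of_subsingleton_left (X M : ModuleCat.{u} R) [Subsingleton X] (n : ℕ) :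
    Subsingleton (Ext X M n) :=
  subsingleton_of_forall_eq 0 fun b => by
    rw [← Ext.mk₀_id_comp b, (ModuleCat.isZero_of_subsingleton X).eq_zero_of_src (𝟙 X),
      Ext.mk₀_zero, Ext.zero_comp]

theorem subsingleton_ext_X₂ {S : ShortComplex (ModuleCat.{u} R)} (hS : S.ShortExact)
    (M : ModuleCat.{u} R) (n : ℕ) (h₁ : Subsingleton (Ext S.X₁ M n))
    (h₃ : Subsingleton (Ext S.X₃ M n)) : Subsingleton (Ext S.X₂ M n) := by
  refine subsingleton_of_forall_eq 0 fun b => ?_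
  obtain ⟨c, rfl⟩ := Ext.contravariant_sequence_exact₂ hS M b (Subsingleton.elim _ _)
  rw [Subsingleton.elim c 0, Ext.comp_zero]

theorem exists_mk₀_comp_eq {S : ShortComplex (ModuleCat.{u} R)} (hS : S.ShortExact)
    {M : ModuleCat.{u} R} {n : ℕ} (h₃ : Subsingleton (Ext S.X₃ M (n + 1))) (a : Ext S.X₁ M n) :
    ∃ b : Ext S.X₂ M n, (Ext.mk₀ S.f).comp b (zero_add n) = a :=
  Ext.contravariant_sequence_exact₁ hS M a (add_comm 1 n) (h₃.allEq _ _)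

theorem subsingleton_ext_of_linearEquiv {X Y : ModuleCat.{u} R} (e : X ≃ₗ[R] Y)
    (M : ModuleCat.{u} R) (n : ℕ) [Subsingleton (Ext Y M n)] : Subsingleton (Ext X M n) :=
  subsingleton_of_forall_eq 0 fun b => by
    rw [← Ext.mk₀_id_comp b, ← e.toModuleIso.hom_inv_id, ← Ext.mk₀_comp_mk₀_assoc,
      Subsingleton.elim ((Ext.mk₀ e.toModuleIso.inv).comp b (zero_add n)) 0, Ext.comp_zero]

/-- `ExtVanishesAt M n` says that `Extⁿ(N, M) = 0` for every finitely generated module `N`; for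
`n = i + 1` this is `inj.dim M ≤ i`. -/
def ExtVanishesAt (M : ModuleCat.{u} R) (n : ℕ) : Prop :=
  ∀ N : ModuleCat.{u} R, Module.Finite R N → Subsingleton (Ext N M n)

namespace ExtVanishesAt

theorem exists_mk₀_comp_eq_of_injective {M : ModuleCat.{u} R} {n : ℕ}
    (hM : ExtVanishesAt M (n + 1)) {X Y : Type u} [AddCommGroup X] [Module R X] [AddCommGroup Y]
    [Module R Y] [Module.Finite R Y] {f : X →ₗ[R] Y} (hf : Function.Injective f)
    (a : Ext (ModuleCat.of R X) M n) :
    ∃ b : Ext (ModuleCat.of R Y) M n,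
      (Ext.mk₀ (ModuleCat.ofHom f)).comp b (zero_add n) = a :=
  have hexact := LinearMap.exact_map_mkQ_range f
  exists_mk₀_comp_eq (ModuleCat.shortComplex_shortExact
      (ModuleCat.shortComplexOfCompEqZero f _ hexact.linearMap_comp_eq_zero) hexact hf
      (Submodule.mkQ_surjective _))
    (hM _ (inferInstanceAs (Module.Finite R (Y ⧸ LinearMap.range f)))) a

variable [IsLocalRing R] [IsNoetherianRing R] {M : ModuleCat.{u} R} [Module.Finite R M] {n : ℕ}

theorem subsingleton_ext_of_isSMulRegular (hM : ExtVanishesAt M (n + 1)) (N : ModuleCat.{u} R)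
    [Module.Finite R N] {y : R} (hy : y ∈ maximalIdeal R) (hreg : IsSMulRegular N y) :
    Subsingleton (Ext N M n) := by
  have smul_surjective (b : Ext N M n) : ∃ c : Ext N M n, y • c = b := by
    obtain ⟨c, hc⟩ : ∃ c : Ext N M n, (Ext.mk₀ (y • 𝟙 N)).comp c (zero_add n) = b :=
      exists_mk₀_comp_eq hreg.smulShortComplex_shortExact
        (hM _ (inferInstanceAs (Module.Finite R (QuotSMulTop y N)))) b
    exact ⟨c, by rwa [Ext.mk₀_smul, Ext.smul_comp, Ext.mk₀_id_comp] at hc⟩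
  have top_le : (⊤ : Submodule R (Ext N M n)) ≤ maximalIdeal R • ⊤ := fun b _ => by
    obtain ⟨c, rfl⟩ := smul_surjective b
    exact Submodule.smul_mem_smul hy trivial
  exact (Submodule.subsingleton_iff R).mp (subsingleton_of_bot_eq_top
    (Submodule.eq_bot_of_le_smul_of_le_jacobson_bot _ _ Module.Finite.fg_top top_le
      (maximalIdeal_le_jacobson _)).symm)

theorem subsingleton_ext_quotient_prime (hM : ExtVanishesAt M (n + 1)) {p : Ideal R}
    [hp : p.IsPrime] (hne : p ≠ maximalIdeal R) :
    Subsingleton (Ext (ModuleCat.of R (R ⧸ p)) M n) := by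
  obtain ⟨y, hy, hyp⟩ := SetLike.exists_of_lt ((le_maximalIdeal hp.ne_top).lt_of_ne hne)
  refine hM.subsingleton_ext_of_isSMulRegular _ hy ?_
  refine (isSMulRegular_iff_right_eq_zero_of_smul (M := R ⧸ p)).mpr fun z hz => ?_
  rw [Algebra.smul_def, Ideal.Quotient.algebraMap_eq, mul_eq_zero] at hz
  exact hz.resolve_left (mt Ideal.Quotient.eq_zero_iff_mem.mp hyp)

theorem of_succ (hM : ExtVanishesAt M (n + 1))
    (hk : Subsingleton (Ext (ModuleCat.of R (R ⧸ maximalIdeal R)) M n)) : ExtVanishesAt M n := by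
  suffices ∀ (N : Type u) [AddCommGroup N] [Module R N], Module.Finite R N →
    Subsingleton (Ext (ModuleCat.of R N) M n) from fun N => this N
  intro N _ _ hN
  induction hN using IsNoetherianRing.induction_on_isQuotientEquivQuotientPrime R with
  | subsingleton N => exact subsingleton_ext_of_subsingleton_left (ModuleCat.of R N) M n
  | quotient N p e =>
    have : Subsingleton (Ext (ModuleCat.of R (R ⧸ p.asIdeal)) M n) := by
      by_cases hp : p.asIdeal = maximalIdeal R
      · rwa [hp]
      · exact hM.subsingleton_ext_quotient_prime hp
    exact subsingleton_ext_of_linearEquiv (X := ModuleCat.of R N) (Y := ModuleCat.of R _) e M n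
  | exact N₁ N₂ N₃ f g hf hg hfg h₁ h₃ =>
    exact subsingleton_ext_X₂ (ModuleCat.shortComplex_shortExact
      (ModuleCat.shortComplexOfCompEqZero f g hfg.linearMap_comp_eq_zero) hfg hf hg) M n h₁ h₃

theorem of_maximalIdeal_mem_associatedPrimes {T : ModuleCat.{u} R} [Module.Finite R T]
    (hT : maximalIdeal R ∈ associatedPrimes R T) (hext : Subsingleton (Ext T M n))
    (hM : ExtVanishesAt M (n + 1)) : ExtVanishesAt M n := by
  obtain ⟨-, ι, hι⟩ := (isAssociatedPrime_iff_exists_injective_linearMap _ _).mp hT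
  refine hM.of_succ (subsingleton_of_forall_eq 0 fun a => ?_)
  obtain ⟨b, rfl⟩ := hM.exists_mk₀_comp_eq_of_injective hι a
  rw [Subsingleton.elim (α := Ext T M n) b 0, Ext.comp_zero]

theorem succ_of_hasProjectiveDimensionLE {T : ModuleCat.{u} R} [Module.Finite R T]
    (hT : maximalIdeal R ∈ associatedPrimes R T) (d : ℕ) [HasProjectiveDimensionLE T d] {m : ℕ}
    [HasInjectiveDimensionLE M m] : ExtVanishesAt M (d + 1) := by
  refine Nat.decreasingInduction' (n := d + m + 1) (P := fun n => ExtVanishesAt M n)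
    (fun k _ hk => of_maximalIdeal_mem_associatedPrimes hT ?_) (by omega) fun N _ => ?_
  · exact HasProjectiveDimensionLT.subsingleton T (d + 1) k hk M
  · exact HasInjectiveDimensionLT.subsingleton M (m + 1) (d + m + 1) (by omega) N

end ExtVanishesAt

end ExtVanishing

section RegularSequenceExt

open CategoryTheory Abelian IsLocalRing RingTheory.Sequence

variable {R : Type u} [CommRing R]

theorem subsingleton_ext_X₁_succ {S : ShortComplex (ModuleCat.{u} R)} (hS : S.ShortExact)
    {X : ModuleCat.{u} R} {n : ℕ}
    (hX : ∀ b : Ext X S.X₁ (n + 1), b.comp (Ext.mk₀ S.f) (add_zero (n + 1)) = 0)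
    (h₃ : Subsingleton (Ext X S.X₃ n)) : Subsingleton (Ext X S.X₁ (n + 1)) := by
  refine subsingleton_of_forall_eq 0 fun b => ?_
  obtain ⟨a, rfl⟩ := Ext.covariant_sequence_exact₁ X hS b (hX b) rfl
  rw [Subsingleton.elim a 0, Ext.zero_comp]

theorem subsingleton_ext_X₃ {S : ShortComplex (ModuleCat.{u} R)} (hS : S.ShortExact)
    (X : ModuleCat.{u} R) (n : ℕ) (h₂ : Subsingleton (Ext X S.X₂ n))
    (h₁ : Subsingleton (Ext X S.X₁ (n + 1))) : Subsingleton (Ext X S.X₃ n) := by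
  refine subsingleton_of_forall_eq 0 fun b => ?_
  obtain ⟨c, rfl⟩ := Ext.covariant_sequence_exact₃ X hS b rfl (Subsingleton.elim _ _)
  rw [Subsingleton.elim c 0, Ext.zero_comp]

theorem mk₀_comp_surjective_X₃ {S : ShortComplex (ModuleCat.{u} R)} (hS : S.ShortExact)
    {X Y : ModuleCat.{u} R} (f : X ⟶ Y) {n : ℕ} (hX : Subsingleton (Ext X S.X₂ n))
    (hY : ∀ b : Ext Y S.X₁ (n + 1), b.comp (Ext.mk₀ S.f) (add_zero (n + 1)) = 0)
    (hf : ∀ a : Ext X S.X₁ (n + 1), ∃ b : Ext Y S.X₁ (n + 1),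
      (Ext.mk₀ f).comp b (zero_add (n + 1)) = a) (a : Ext X S.X₃ n) :
    ∃ b : Ext Y S.X₃ n, (Ext.mk₀ f).comp b (zero_add n) = a := by
  obtain ⟨c, hc⟩ := hf (a.comp hS.extClass rfl)
  obtain ⟨b, rfl⟩ := Ext.covariant_sequence_exact₁ Y hS c (hY c) rfl
  have hδ : ((Ext.mk₀ f).comp b (zero_add n) - a).comp hS.extClass rfl = 0 := by
    rw [sub_eq_add_neg, Ext.add_comp, Ext.neg_comp, ← hc,
      Ext.comp_assoc _ _ _ (zero_add n) rfl (by omega), add_neg_cancel]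
  obtain ⟨d, hd⟩ := Ext.covariant_sequence_exact₃ X hS _ rfl hδ
  rw [Subsingleton.elim d 0, Ext.zero_comp] at hd
  exact ⟨b, sub_eq_zero.mp hd.symm⟩

theorem comp_mk₀_smulShortComplex_f_eq_zero {X : ModuleCat.{u} R} {y : R}
    (hy : y ∈ Module.annihilator R X) (M : ModuleCat.{u} R) {n : ℕ} (b : Ext X M n) :
    b.comp (Ext.mk₀ (M.smulShortComplex y).f) (add_zero n) = 0 := by
  change b.comp (Ext.mk₀ (y • 𝟙 M)) (add_zero n) = 0
  rw [Ext.mk₀_smul, Ext.comp_smul, Ext.comp_mk₀_id, ext_smul_eq_zero_of_mem_annihilator hy]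

/-- The case of the empty sequence `rs` in the inductions on quotients `M ⧸ (rs)M`; the quotient by
a nonempty sequence is handled by `Submodule.quotOfListConsSMulTopEquivQuotSMulTopInner`. -/
def quotOfListNilSMulTopEquiv (R M : Type*) [CommRing R] [AddCommGroup M] [Module R M] :
    (M ⧸ (Ideal.ofList ([] : List R) • ⊤ : Submodule R M)) ≃ₗ[R] M :=
  Submodule.quotEquivOfEqBot _ (by rw [Ideal.ofList_nil, Submodule.bot_smul])

theorem subsingleton_ext_of_isWeaklyRegular {X : ModuleCat.{u} R} {rs : List R}
    (hX : Ideal.ofList rs ≤ Module.annihilator R X) {M : Type u} [AddCommGroup M] [Module R M]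
    (hreg : IsWeaklyRegular M rs) {n : ℕ} (hn : n < rs.length) :
    Subsingleton (Ext X (ModuleCat.of R M) n) := by
  induction rs generalizing M n with
  | nil => simp at hn
  | cons y rs ih =>
    rw [isWeaklyRegular_cons_iff] at hreg
    rw [Ideal.ofList_cons, sup_le_iff, Ideal.span_singleton_le_iff_mem] at hX
    cases n with
    | zero =>
      have := IsSMulRegular.linearMap_subsingleton_of_mem_annihilator hreg.1 hX.1
      have : Subsingleton (X ⟶ ModuleCat.of R M) := ModuleCat.homEquiv.subsingleton
      exact Ext.homEquiv₀.subsingleton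
    | succ n =>
      exact subsingleton_ext_X₁_succ
        (IsSMulRegular.smulShortComplex_shortExact (M := ModuleCat.of R M) hreg.1)
        (comp_mk₀_smulShortComplex_f_eq_zero hX.1 _) (ih hX.2 hreg.2 (Nat.succ_lt_succ_iff.mp hn))

theorem exists_extension_to_quotient_of_isWeaklyRegular {X Y : ModuleCat.{u} R} (f : X ⟶ Y)
    {rs : List R} (hX : Ideal.ofList rs ≤ Module.annihilator R X)
    (hY : Ideal.ofList rs ≤ Module.annihilator R Y)
    {M : Type u} [AddCommGroup M] [Module R M] (hreg : IsWeaklyRegular M rs)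
    (hf : ∀ a : Ext X (ModuleCat.of R M) rs.length, ∃ b : Ext Y (ModuleCat.of R M) rs.length,
      (Ext.mk₀ f).comp b (zero_add rs.length) = a)
    (g : X →ₗ[R] M ⧸ (Ideal.ofList rs • ⊤ : Submodule R M)) :
    ∃ h : Y →ₗ[R] M ⧸ (Ideal.ofList rs • ⊤ : Submodule R M), h ∘ₗ f.hom = g := by
  induction rs generalizing M with
  | nil =>
    let e := quotOfListNilSMulTopEquiv R M
    obtain ⟨b, hb⟩ := hf (Ext.mk₀ (ModuleCat.ofHom (e.toLinearMap ∘ₗ g)))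
    obtain ⟨h, rfl⟩ := (Ext.mk₀_bijective _ _).2 b
    rw [Ext.mk₀_comp_mk₀, (Ext.mk₀_bijective _ _).1.eq_iff] at hb
    refine ⟨e.symm.toLinearMap ∘ₗ h.hom, LinearMap.ext fun x => ?_⟩
    simpa [LinearEquiv.symm_apply_eq] using LinearMap.congr_fun (ModuleCat.hom_ext_iff.mp hb) x
  | cons y rs ih =>
    have hXn := subsingleton_ext_of_isWeaklyRegular hX hreg (Nat.lt_succ_self rs.length)
    rw [isWeaklyRegular_cons_iff] at hreg
    rw [Ideal.ofList_cons, sup_le_iff, Ideal.span_singleton_le_iff_mem] at hX hY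
    let e := Submodule.quotOfListConsSMulTopEquivQuotSMulTopInner M y rs
    obtain ⟨h, hh⟩ := ih hX.2 hY.2 hreg.2
      (mk₀_comp_surjective_X₃
        (IsSMulRegular.smulShortComplex_shortExact (M := ModuleCat.of R M) hreg.1) f hXn
        (comp_mk₀_smulShortComplex_f_eq_zero hY.1 _) hf) (e.toLinearMap ∘ₗ g)
    refine ⟨e.symm.toLinearMap ∘ₗ h, ?_⟩
    rw [LinearMap.comp_assoc, hh, ← LinearMap.comp_assoc, LinearEquiv.symm_comp, LinearMap.id_comp]

theorem injective_quotient_ofList_of_isWeaklyRegular {rs : List R}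
    (hreg : IsWeaklyRegular R rs) (hext : ExtVanishesAt (ModuleCat.of R R) (rs.length + 1)) :
    Module.Injective (R ⧸ Ideal.ofList rs) (R ⧸ Ideal.ofList rs) := by
  set A := R ⧸ Ideal.ofList rs
  have le_annihilator (N : Type u) [AddCommGroup N] [Module R N] [Module A N]
      [IsScalarTower R A N] : Ideal.ofList rs ≤ Module.annihilator R N := fun r hr =>
    Module.mem_annihilator.mpr fun x => by
      rw [← algebraMap_smul A r x, Ideal.Quotient.algebraMap_eq,
        Ideal.Quotient.eq_zero_iff_mem.mpr hr, zero_smul]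
  have hI : (Ideal.ofList rs • ⊤ : Ideal R) = Ideal.ofList rs := by rw [smul_eq_mul, Ideal.mul_top]
  refine Module.Baer.injective (Module.Baer.iff_surjective.mpr fun I g => ?_)
  let e := Submodule.quotEquivOfEq _ _ hI
  obtain ⟨h, hh⟩ := exists_extension_to_quotient_of_isWeaklyRegular
    (ModuleCat.ofHom (I.subtype.restrictScalars R))
    (le_annihilator I) (le_annihilator A) hreg
    (hext.exists_mk₀_comp_eq_of_injective I.subtype_injective)
    (e.symm.toLinearMap ∘ₗ g.restrictScalars R)
  refine ⟨(e.toLinearMap ∘ₗ h).extendScalarsOfSurjective Ideal.Quotient.mk_surjective,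
    LinearMap.ext fun x => ?_⟩
  exact (e.symm_apply_eq.mp (LinearMap.congr_fun hh x).symm).symm

end RegularSequenceExt

section Depth

open IsLocalRing RingTheory.Sequence Module Pointwise

variable {R M : Type*} [CommRing R] [IsNoetherianRing R] [AddCommGroup M] [Module R M]
  [Module.Finite R M]

theorem ringKrullDim_quotient_le_supportDim_quotSMulTop {y : R} {p : Ideal R}
    (hp : p ∈ associatedPrimes R M) (hy : y ∈ p) :
    ringKrullDim (R ⧸ p) ≤ supportDim R (QuotSMulTop y M) := by
  obtain ⟨-, ι, hι⟩ := (isAssociatedPrime_iff_exists_injective_linearMap _ _).mp hp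
  have hsub : support R (R ⧸ p) ⊆ support R (QuotSMulTop y M) := by
    rw [support_quotSMulTop]
    refine Set.subset_inter (support_subset_of_injective ι hι) ?_
    rw [support_eq_zeroLocus, Ideal.annihilator_quotient]
    exact PrimeSpectrum.zeroLocus_anti_mono (Set.singleton_subset_iff.mpr hy)
  rw [← supportDim_quotient_eq_ringKrullDim]
  exact Order.krullDim_le_of_strictMono (Set.inclusion hsub) fun _ _ h => h

variable [IsLocalRing R]

theorem exists_isSMulRegular_of_maximalIdeal_notMem_associatedPrimes
    (hM : maximalIdeal R ∉ associatedPrimes R M) : ∃ y ∈ maximalIdeal R, IsSMulRegular M y := by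
  by_contra! hcon
  refine hM ((Ideal.subset_iUnion_iff_mem_of_isMaximal_of_finite (associatedPrimes.finite R M) ⊥ ⊥
    (fun p hp _ _ => hp.1) bot_ne_top bot_ne_top).mp ?_)
  rw [biUnion_associatedPrimes_eq_compl_regular]
  exact fun y hy => hcon y hy

theorem exists_isRegular_maximalIdeal_mem_associatedPrimes (R M : Type*) [CommRing R]
    [IsLocalRing R] [IsNoetherianRing R] [AddCommGroup M] [Module R M] [Module.Finite R M]
    [Nontrivial M] :
    ∃ rs : List R, (∀ r ∈ rs, r ∈ maximalIdeal R) ∧ IsRegular M rs ∧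
      maximalIdeal R ∈ associatedPrimes R (M ⧸ (Ideal.ofList rs • ⊤ : Submodule R M)) := by
  obtain ⟨n, hn⟩ : ∃ n : ℕ, supportDim R M < n := by
    obtain ⟨d, hd⟩ := WithBot.ne_bot_iff_exists.mp (supportDim_ne_bot_of_nontrivial R M)
    have hd_ne_top : d ≠ ⊤ := by
      rintro rfl
      exact ((supportDim_le_ringKrullDim R M).trans_lt ringKrullDim_lt_top).ne hd.symm
    obtain ⟨m, rfl⟩ := ENat.ne_top_iff_exists.mp hd_ne_top
    exact ⟨m + 1, hd ▸ (by exact_mod_cast Nat.lt_succ_self m)⟩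
  induction n generalizing M with
  | zero => exact absurd hn (not_lt.mpr (Order.krullDim_nonneg_iff.mpr
      nonempty_support_of_nontrivial.to_subtype))
  | succ n ih =>
    by_cases hM : maximalIdeal R ∈ associatedPrimes R M
    · refine ⟨[], by simp, IsRegular.nil R M, ?_⟩
      rwa [LinearEquiv.AssociatedPrimes.eq (quotOfListNilSMulTopEquiv R M)]
    · obtain ⟨y, hy, hreg⟩ := exists_isSMulRegular_of_maximalIdeal_notMem_associatedPrimes hM
      have := nontrivial_quotSMulTop_of_mem_maximalIdeal M hy
      obtain ⟨rs, hrs, hreg', hass⟩ := ih (QuotSMulTop y M) <| by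
        rw [← supportDim_quotSMulTop_succ_eq_supportDim hreg hy] at hn
        push_cast at hn
        exact lt_of_add_lt_add_right hn
      refine ⟨y :: rs, List.forall_mem_cons.mpr ⟨hy, hrs⟩,
        (isRegular_cons_iff M y rs).mpr ⟨hreg, hreg'⟩, ?_⟩
      rwa [LinearEquiv.AssociatedPrimes.eq
        (Submodule.quotOfListConsSMulTopEquivQuotSMulTopInner M y rs)]

theorem exists_mem_associatedPrimes_quotSMulTop {y : R} (hy : y ∈ maximalIdeal R)
    (hreg : IsSMulRegular M y) {p : Ideal R} (hp : p ∈ associatedPrimes R M) :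
    ∃ q ∈ associatedPrimes R (QuotSMulTop y M), p < q := by
  obtain ⟨hprime, x, hx⟩ := isAssociatedPrime_iff.mp hp
  have mem_iff {m : M} : m ∈ Submodule.torsionBySet R M p ↔ ∀ r ∈ p, r • m = 0 := by
    simp [Submodule.mem_torsionBySet_iff]
  obtain ⟨a, ha, hay⟩ : ∃ a ∈ Submodule.torsionBySet R M p, a ∉ y • (⊤ : Submodule R M) := by
    by_contra! hcon
    have hbot : Submodule.torsionBySet R M p = ⊥ :=
      Submodule.eq_bot_of_le_smul_of_le_jacobson_bot (maximalIdeal R) _ (IsNoetherian.noetherian _)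
        (fun m hm => by
          obtain ⟨m, -, rfl⟩ := hcon m hm
          refine Submodule.smul_mem_smul hy (mem_iff.mpr fun r hr => hreg ?_)
          simpa [smul_comm y r] using mem_iff.mp hm r hr)
        (maximalIdeal_le_jacobson _)
    have hx0 : x = 0 := by
      rw [← Submodule.mem_bot R, ← hbot, mem_iff]
      intro r hr
      simpa [hx, Submodule.mem_colon_singleton] using hr
    exact hprime.ne_top (by rw [hx, hx0]; simp)
  obtain ⟨q, hq, hle⟩ := exists_le_isAssociatedPrime_of_isNoetherianRing R
    (Submodule.Quotient.mk a : QuotSMulTop y M) (mt (Submodule.Quotient.mk_eq_zero _).mp hay)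
  refine ⟨q, hq, lt_of_le_of_ne (fun r hr => hle ?_) ?_⟩
  · rw [Submodule.mem_colon_singleton, Submodule.mem_bot, ← Submodule.Quotient.mk_smul,
      mem_iff.mp ha r hr, Submodule.Quotient.mk_zero]
  · rintro rfl
    have hyp : y ∈ p := hle <| Submodule.mem_colon_singleton.mpr <| (Submodule.mem_bot R).mpr <|
      (Submodule.Quotient.mk_eq_zero _).mpr (Submodule.smul_mem_pointwise_smul a y ⊤ trivial)
    have hmem : y ∈ ⋃ p ∈ associatedPrimes R M, (p : Set R) := Set.mem_biUnion hp hyp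
    rw [biUnion_associatedPrimes_eq_compl_regular] at hmem
    exact hmem hreg

theorem length_le_ringKrullDim_quotient_of_mem_associatedPrimes {rs : List R}
    (hrs : ∀ r ∈ rs, r ∈ maximalIdeal R) (hreg : IsWeaklyRegular M rs) {p : Ideal R}
    (hp : p ∈ associatedPrimes R M) : (rs.length : WithBot ℕ∞) ≤ ringKrullDim (R ⧸ p) := by
  have hprime : p.IsPrime := hp.1
  induction rs generalizing M p with
  | nil => exact ringKrullDim_nonneg_of_nontrivial
  | cons y rs ih =>
    rw [isWeaklyRegular_cons_iff] at hreg
    rw [List.forall_mem_cons] at hrs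
    obtain ⟨q, hq, hpq⟩ := exists_mem_associatedPrimes_quotSMulTop hrs.1 hreg.1 hp
    obtain ⟨z, hzq, hzp⟩ := SetLike.exists_of_lt hpq
    calc ((y :: rs).length : WithBot ℕ∞) = rs.length + 1 := by push_cast [List.length_cons]; rfl
      _ ≤ ringKrullDim (R ⧸ q) + 1 := by gcongr; exact ih hrs.2 hreg.2 hq hq.1
      _ ≤ ringKrullDim (R ⧸ p) := ringKrullDim_succ_le_of_surjective
        (Ideal.Quotient.factor hpq.le) (Ideal.Quotient.factor_surjective hpq.le)
        (mem_nonZeroDivisors_of_ne_zero (mt Ideal.Quotient.eq_zero_iff_mem.mp hzp))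
        (Ideal.Quotient.eq_zero_iff_mem.mpr hzq)

theorem supportDim_le_supportDim_quotient_add_length {rs : List R}
    (hrs : ∀ r ∈ rs, r ∈ maximalIdeal R) :
    supportDim R M ≤ supportDim R (M ⧸ (Ideal.ofList rs • ⊤ : Submodule R M)) + rs.length := by
  induction rs generalizing M with
  | nil =>
    simp [supportDim_eq_of_equiv (quotOfListNilSMulTopEquiv R M)]
  | cons y rs ih =>
    rw [List.forall_mem_cons] at hrs
    rw [supportDim_eq_of_equiv (Submodule.quotOfListConsSMulTopEquivQuotSMulTopInner M y rs),
      List.length_cons, Nat.cast_succ, ← add_assoc]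
    exact (supportDim_le_supportDim_quotSMulTop_succ hrs.1).trans (by gcongr; exact ih hrs.2)

end Depth

section ExtDepth

open CategoryTheory Abelian IsLocalRing RingTheory.Sequence Module

variable {R M : Type u} [CommRing R] [IsLocalRing R] [IsNoetherianRing R] [AddCommGroup M]
  [Module R M] [Module.Finite R M]

theorem exists_isRegular_of_subsingleton_ext [Nontrivial M] {n : ℕ}
    (hext : ∀ i < n,
      Subsingleton (Ext (ModuleCat.of R (R ⧸ maximalIdeal R)) (ModuleCat.of R M) i)) :
    ∃ rs : List R, rs.length = n ∧ (∀ r ∈ rs, r ∈ maximalIdeal R) ∧ IsRegular M rs := by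
  refine ModuleCat.exists_isRegular_of_exists_subsingleton_ext (maximalIdeal R) n
    (ModuleCat.of R M) ?_ (ModuleCat.of R (R ⧸ maximalIdeal R)) ?_ hext
  · exact lt_top_iff_ne_top.mpr (Submodule.top_ne_ideal_smul_of_le_jacobson_annihilator
      (IsLocalRing.maximalIdeal_le_jacobson _)).symm
  · change support R (R ⧸ maximalIdeal R) = _
    rw [support_eq_zeroLocus, Ideal.annihilator_quotient]

theorem isWeaklyRegular_of_subsingleton_ext {rs : List R} (hrs : ∀ r ∈ rs, r ∈ maximalIdeal R)
    (hext : ∀ i < rs.length,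
      Subsingleton (Ext (ModuleCat.of R (R ⧸ maximalIdeal R)) (ModuleCat.of R M) i))
    (hdim : supportDim R (M ⧸ (Ideal.ofList rs • ⊤ : Submodule R M)) ≤ 0) :
    IsWeaklyRegular M rs := by
  induction rs generalizing M with
  | nil => exact IsWeaklyRegular.nil R M
  | cons y rs ih =>
    rw [supportDim_eq_of_equiv (Submodule.quotOfListConsSMulTopEquivQuotSMulTopInner M y rs)]
      at hdim
    rw [List.forall_mem_cons] at hrs
    have hreg : IsSMulRegular M y := by
      by_contra hy
      have hmem : y ∈ ⋃ p ∈ associatedPrimes R M, (p : Set R) := by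
        rwa [biUnion_associatedPrimes_eq_compl_regular]
      obtain ⟨p, hp, hyp⟩ := Set.mem_iUnion₂.mp hmem
      have : Nontrivial M := not_subsingleton_iff_nontrivial.mp fun _ =>
        Set.notMem_empty p (associatedPrimes.eq_empty_of_subsingleton (R := R) (M := M) ▸ hp)
      obtain ⟨ys, hlen, hys, hysreg⟩ := exists_isRegular_of_subsingleton_ext hext
      have hle : ((y :: rs).length : WithBot ℕ∞) ≤ rs.length := calc
        ((y :: rs).length : WithBot ℕ∞) ≤ ringKrullDim (R ⧸ p) := by
          rw [← hlen]
          exact length_le_ringKrullDim_quotient_of_mem_associatedPrimes hys hysreg.1 hp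
        _ ≤ supportDim R (QuotSMulTop y M) :=
          ringKrullDim_quotient_le_supportDim_quotSMulTop hp hyp
        _ ≤ _ + rs.length := supportDim_le_supportDim_quotient_add_length hrs.2
        _ ≤ 0 + rs.length := by gcongr
        _ = rs.length := zero_add _
      exact absurd (by exact_mod_cast hle) (Nat.not_succ_le_self rs.length)
    refine (isWeaklyRegular_cons_iff M y rs).mpr ⟨hreg, ih hrs.2 (fun i hi => ?_) hdim⟩
    exact subsingleton_ext_X₃
      (IsSMulRegular.smulShortComplex_shortExact (M := ModuleCat.of R M) hreg) _ i
      (hext i (Nat.lt_succ_of_lt hi)) (hext (i + 1) (Nat.succ_lt_succ hi))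

end ExtDepth

section Gorenstein

open CategoryTheory Abelian IsLocalRing RingTheory.Sequence Module

variable {R : Type u} [CommRing R] [IsLocalRing R]

namespace IsSystemOfParameters

variable {d : ℕ} {x : Fin d → R}

theorem pow (hx : IsSystemOfParameters x) {t : ℕ} (ht : t ≠ 0) :
    IsSystemOfParameters fun i => x i ^ t := by
  refine ⟨hx.1, ?_⟩
  rw [← hx.2]
  refine le_antisymm (Ideal.radical_mono ?_) ?_
  · rw [Ideal.span_le]
    rintro _ ⟨i, rfl⟩
    exact Ideal.pow_mem_of_mem _ (Ideal.subset_span (Set.mem_range_self i)) t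
      (Nat.pos_of_ne_zero ht)
  · rw [Ideal.radical_le_radical_iff, Ideal.span_le]
    rintro _ ⟨i, rfl⟩
    exact ⟨t, Ideal.subset_span ⟨i, rfl⟩⟩

theorem span_range_pow_le (hx : IsSystemOfParameters x) (t : ℕ) :
    Ideal.span (Set.range fun i => x i ^ t) ≤ maximalIdeal R ^ t := by
  rw [Ideal.span_le, ← hx.2]
  rintro _ ⟨i, rfl⟩
  exact Ideal.pow_mem_pow (Ideal.le_radical (Ideal.subset_span (Set.mem_range_self i))) t

end IsSystemOfParameters

variable [IsNoetherianRing R]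

theorem ExtVanishesAt.eq_maximalIdeal_of_mem_associatedPrimes {M : ModuleCat.{u} R}
    [Module.Finite R M] (hM : ExtVanishesAt M 1) {p : Ideal R} (hp : p ∈ associatedPrimes R M) :
    p = maximalIdeal R := by
  by_contra hne
  obtain ⟨hprime, ι, hι⟩ := (isAssociatedPrime_iff_exists_injective_linearMap _ _).mp hp
  have := hM.subsingleton_ext_quotient_prime hne
  have : Subsingleton (ModuleCat.of R (R ⧸ p) ⟶ M) := Ext.homEquiv₀.symm.subsingleton
  have hzero : ι = 0 := congrArg ModuleCat.Hom.hom
    (Subsingleton.elim (ModuleCat.ofHom ι : ModuleCat.of R (R ⧸ p) ⟶ M) 0)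
  exact one_ne_zero (hι ((LinearMap.congr_fun hzero 1).trans (map_zero ι).symm))

theorem ringKrullDim_eq_zero_of_injective [Module.Injective R R] : ringKrullDim R = 0 := by
  have := injective_object_of_injective_module R R
  have hext : ExtVanishesAt (ModuleCat.of R R) 1 := fun N _ =>
    HasInjectiveDimensionLT.subsingleton _ 1 1 le_rfl N
  refine le_antisymm (Ring.krullDimLE_iff.mp (Ring.krullDimLE_zero_iff.mpr fun q hq => ?_))
    ringKrullDim_nonneg_of_nontrivial
  obtain ⟨p, hp, hpq⟩ := Ideal.exists_minimalPrimes_le (bot_le : ⊥ ≤ q)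
  rw [← annihilator_eq_bot.mpr (inferInstance : FaithfulSMul R R)] at hp
  rw [hext.eq_maximalIdeal_of_mem_associatedPrimes (M := ModuleCat.of R R)
    (associatedPrimes.minimalPrimes_annihilator_subset_associatedPrimes R R hp)] at hpq
  rw [← (maximalIdeal.isMaximal R).eq_of_le hq.ne_top hpq]
  exact maximalIdeal.isMaximal R

theorem injective_quotient_ofList_of_maximalIdeal_mem_associatedPrimes (m : ℕ)
    [HasInjectiveDimensionLE (ModuleCat.of R R) m] {rs : List R}
    (hrs : ∀ r ∈ rs, r ∈ maximalIdeal R) (hreg : IsWeaklyRegular R rs)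
    (hass : maximalIdeal R ∈ associatedPrimes R (R ⧸ (Ideal.ofList rs • ⊤ : Ideal R))) :
    Module.Injective (R ⧸ Ideal.ofList rs) (R ⧸ Ideal.ofList rs) := by
  let T := ModuleCat.of R (R ⧸ (Ideal.ofList rs • ⊤ : Ideal R))
  have hT : HasProjectiveDimensionLE T rs.length := by
    rw [← projectiveDimension_le_iff]
    refine (ModuleCat.projectiveDimension_quotient_eq_add_length_of_isWeaklyRegular
      (ModuleCat.of R R) rs hreg hrs).trans_le ?_
    rw [ModuleCat.projectiveDimension_eq_zero_of_projective, zero_add]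
  exact injective_quotient_ofList_of_isWeaklyRegular hreg
    (ExtVanishesAt.succ_of_hasProjectiveDimensionLE (T := T) hass rs.length (m := m))

theorem exists_isRegular_length_eq_ringKrullDim (m : ℕ)
    [HasInjectiveDimensionLE (ModuleCat.of R R) m] :
    ∃ rs : List R, (∀ r ∈ rs, r ∈ maximalIdeal R) ∧ IsRegular R rs ∧
      (rs.length : WithBot ℕ∞) = ringKrullDim R := by
  obtain ⟨rs, hrs, hreg, hass⟩ := exists_isRegular_maximalIdeal_mem_associatedPrimes R R
  have := injective_quotient_ofList_of_maximalIdeal_mem_associatedPrimes m hrs hreg.1 hass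
  have : Nontrivial (R ⧸ Ideal.ofList rs) := Ideal.Quotient.nontrivial_iff.mpr
    ((Ideal.span_le.mpr hrs).trans_lt (maximalIdeal.isMaximal R).ne_top.lt_top).ne
  have := IsLocalRing.of_surjective' _ (Ideal.Quotient.mk_surjective (I := Ideal.ofList rs))
  refine ⟨rs, hrs, hreg, ?_⟩
  rw [← ringKrullDim_add_length_eq_ringKrullDim_of_isRegular rs hreg,
    ringKrullDim_eq_zero_of_injective, zero_add]

theorem supportDim_quotient_le_zero_of_radical_eq_maximalIdeal {J : Ideal R}
    (hJ : J.radical = maximalIdeal R) : supportDim R (R ⧸ J) ≤ 0 := by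
  have := isArtinianRing_quotient_of_radical_eq_maximalIdeal hJ
  rw [supportDim_quotient_eq_ringKrullDim]
  exact Ring.krullDimLE_iff.mp inferInstance

theorem maximalIdeal_mem_associatedPrimes_quotient {J : Ideal R}
    (hJ : J.radical = maximalIdeal R) : maximalIdeal R ∈ associatedPrimes R (R ⧸ J) := by
  have : Nontrivial (R ⧸ J) := Ideal.Quotient.nontrivial_iff.mpr fun h => by
    rw [h, Ideal.radical_top] at hJ
    exact (maximalIdeal.isMaximal R).ne_top hJ.symm
  obtain ⟨p, hp⟩ := associatedPrimes.nonempty R (R ⧸ J)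
  have hJp : J ≤ p := by
    rw [← Ideal.annihilator_quotient (I := J), ← Submodule.annihilator_top]
    exact hp.annihilator_le
  have hmp : maximalIdeal R ≤ p := hJ ▸ hp.1.radical_le_iff.mpr hJp
  rwa [(maximalIdeal.isMaximal R).eq_of_le hp.1.ne_top hmp]

theorem IsSystemOfParameters.injective_quotient (m : ℕ)
    [HasInjectiveDimensionLE (ModuleCat.of R R) m] {d : ℕ} {x : Fin d → R}
    (hx : IsSystemOfParameters x) :
    Module.Injective (R ⧸ Ideal.span (Set.range x)) (R ⧸ Ideal.span (Set.range x)) := by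
  have hspan : Ideal.span (Set.range x) = Ideal.ofList (List.ofFn x) := by
    simp [Ideal.ofList, List.mem_ofFn', Set.range]
  obtain ⟨hdim, hrad⟩ := hx
  rw [hspan] at hrad ⊢
  have htop : (Ideal.ofList (List.ofFn x) • ⊤ : Ideal R) = Ideal.ofList (List.ofFn x) := by
    rw [smul_eq_mul, Ideal.mul_top]
  have hmem : ∀ r ∈ List.ofFn x, r ∈ maximalIdeal R := fun r hr =>
    hrad ▸ Ideal.le_radical (Ideal.subset_span hr)
  obtain ⟨ys, hys, hreg, hlen⟩ := exists_isRegular_length_eq_ringKrullDim (R := R) m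
  have hext : ∀ i < (List.ofFn x).length,
      Subsingleton (Ext (ModuleCat.of R (R ⧸ maximalIdeal R)) (ModuleCat.of R R) i) := by
    intro i hi
    refine subsingleton_ext_of_isWeaklyRegular (rs := ys) ?_ hreg.1 ?_
    · change Ideal.ofList ys ≤ Module.annihilator R (R ⧸ maximalIdeal R)
      rw [Ideal.annihilator_quotient]
      exact Ideal.span_le.mpr hys
    · rw [List.length_ofFn] at hi
      rw [hdim] at hlen
      exact hi.trans_eq (by exact_mod_cast hlen.symm)
  refine injective_quotient_ofList_of_maximalIdeal_mem_associatedPrimes m hmem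
    (isWeaklyRegular_of_subsingleton_ext hmem hext ?_) ?_
  · rw [htop]
    exact supportDim_quotient_le_zero_of_radical_eq_maximalIdeal hrad
  · rw [htop]
    exact maximalIdeal_mem_associatedPrimes_quotient hrad

end Gorenstein

theorem mainTheorem6_general {R : Type u} [CommRing R] [IsLocalRing R] [IsNoetherianRing R]
    (𝓜 : ModuleClass R)
    (hfg : ∀ (M : Type u) [AddCommGroup M] [Module R M], Module.Finite R M → 𝓜.Mem M)
    (cl : ClosureOperation 𝓜) (hfun : cl.IsFunctorial) (hres : cl.IsResidual) :
    (∀ J : ℕ → Ideal R,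
      (∀ t, InfIrred (J t)) →
      (∀ t, IsMaxPrimary (J t)) →
      (∀ n : ℕ, ∃ t, J t ≤ IsLocalRing.maximalIdeal R ^ n) →
      (∀ t, cl R (hfg R inferInstance) (J t) = J t) →
      (∀ I : Ideal R, cl R (hfg R inferInstance) I = I) ∧
      (∀ (M : Type u) [AddCommGroup M] [Module R M] (hM : Module.Finite R M),
        cl M (hfg M hM) ⊥ = ⊥)) ∧
    (IsGorensteinLocal R →
      ∀ (d : ℕ) (x : Fin d → R), IsSystemOfParameters x →
        {t : ℕ | cl R (hfg R inferInstance) (Ideal.span (Set.range fun i => x i ^ t)) =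
          Ideal.span (Set.range fun i => x i ^ t)}.Infinite →
        (∀ I : Ideal R, cl R (hfg R inferInstance) I = I) ∧
        (∀ (M : Type u) [AddCommGroup M] [Module R M] (hM : Module.Finite R M),
          cl M (hfg M hM) ⊥ = ⊥)) := by
  have hideal (hbot : ∀ (M : Type u) [AddCommGroup M] [Module R M] (hM : Module.Finite R M),
      cl M (hfg M hM) ⊥ = ⊥) (I : Ideal R) : cl R (hfg R inferInstance) I = I :=
    (hres.bot_quotient_eq_bot_iff _ I _).mp (hbot (R ⧸ I) inferInstance)
  constructor
  · intro J hirr hprim hcof hcl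
    have hbot (M : Type u) [AddCommGroup M] [Module R M] (hM : Module.Finite R M) :=
      cl.bot_eq_bot_of_injective_quotient hfun hres (hfg R inferInstance) (fun n =>
        let ⟨t, ht⟩ := hcof n
        ⟨J t, ht, (hprim t).2, injective_self_quotient_of_infIrred (hirr t) (hprim t).2, hcl t⟩)
        (hfg M hM)
    exact ⟨hideal hbot, hbot⟩
  · intro hG d x hx hinf
    obtain ⟨m, hm⟩ := hG.finite_injectiveDimension
    have hbot (M : Type u) [AddCommGroup M] [Module R M] (hM : Module.Finite R M) :=
      cl.bot_eq_bot_of_injective_quotient hfun hres (hfg R inferInstance) (fun n =>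
        let ⟨t, ht, hnt⟩ := hinf.exists_gt n
        have hxt := hx.pow (Nat.ne_zero_of_lt hnt)
        ⟨_, (hx.span_range_pow_le t).trans (Ideal.pow_le_pow_right hnt.le), hxt.2,
          hxt.injective_quotient m, ht⟩)
        (hfg M hM)
    exact ⟨hideal hbot, hbot⟩

theorem mainTheorem6 {R : Type u} [CommRing R] [IsLocalRing R] [IsNoetherianRing R]
    [IsAdicComplete (IsLocalRing.maximalIdeal R) R]
    (𝓜 : ModuleClass R)
    (hfg : ∀ (M : Type u) [AddCommGroup M] [Module R M], Module.Finite R M → 𝓜.Mem M)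
    (cl : ClosureOperation 𝓜) (hfun : cl.IsFunctorial) (hres : cl.IsResidual) :
    (IsApproximatelyGorenstein R →
      ∀ J : ℕ → Ideal R,
        (∀ t, InfIrred (J t)) →
        (∀ t, IsMaxPrimary (J t)) →
        (∀ n : ℕ, ∃ t, J t ≤ IsLocalRing.maximalIdeal R ^ n) →
        (∀ t, cl R (hfg R inferInstance) (J t) = J t) →
        (∀ I : Ideal R, cl R (hfg R inferInstance) I = I) ∧
        (∀ (M : Type u) [AddCommGroup M] [Module R M] (hM : Module.Finite R M),
          cl M (hfg M hM) ⊥ = ⊥)) ∧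
    (IsGorensteinLocal R →
      ∀ (d : ℕ) (x : Fin d → R), IsSystemOfParameters x →
        {t : ℕ | cl R (hfg R inferInstance) (Ideal.span (Set.range fun i => x i ^ t)) =
          Ideal.span (Set.range fun i => x i ^ t)}.Infinite →
        (∀ I : Ideal R, cl R (hfg R inferInstance) I = I) ∧
        (∀ (M : Type u) [AddCommGroup M] [Module R M] (hM : Module.Finite R M),
          cl M (hfg M hM) ⊥ = ⊥)) :=
  (mainTheorem6_general 𝓜 hfg cl hfun hres).imp_left fun h _ => h
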